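/- Let $M$ be an $n$-dimensional $C^\infty$ manifold and let $L$ be a Finsler metric function on $TM$ (smooth and positive off the zero section, positively homogeneous of degree $1$ in $y$, with $g_{ij}=\tfrac12\dot\partial_i\dot\partial_j L^2$ positive definite), where $\partial_i=\partial/\partial x^i$ and $\dot\partial_i=\partial/\partial y^i$ in natural coordinates $(x^i,y^i)$ of $TM$. Let $\sigma$ be a smooth function and $\beta=b_i(x)y^i$ a smooth $1$-form on $M$ such that $$\overline L(x,y)=e^{\sigma(x)}L(x,y)+\beta(x,y)$$ is again a Finsler metric function. Let $\Gamma^i_{jk}=\tfrac12 g^{il}(\delta_j g_{lk}+\delta_k g_{jl}-\delta_l g_{jk})$ be the horizontal coefficients of the Cartan connection of $(M,L)$, where $\delta_k=\partial_k-N^r_k\dot\partial_r$, $N^i_j=\tfrac12\dot\partial_j S^i$ $(=y^k\Gamma^i_{jk})$ is the canonical nonlinear connection and $S^i=\tfrac12 g^{il}(y^k\partial_k\dot\partial_l L^2-\partial_l L^2)$ is the canonical spray. Let $P^i_{jk}=\dot\partial_k N^i_j-\Gamma^i_{kj}$ be the (v)hv-torsion and $P_{hjk}=g_{ih}P^i_{jk}$;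 the barred objects are those of $(M,\overline L)$. Put $D^i_{jk}=\overline\Gamma{}^i_{jk}-\Gamma^i_{jk}$, $D^i_{0k}=D^i_{jk}y^j$, $D^i_{00}=D^i_{jk}y^jy^k$, $L_{hjk}=\dot\partial_k\dot\partial_j\dot\partial_h L$, $L_{hjkr}=\dot\partial_r L_{hjk}$, $\sigma_0=(\partial_i\sigma)\,y^i$ and $\tau=e^{\sigma}\overline L/L$. Then, in every chart, at every point and for every $y\neq0$ and all indices $h,j,k$, $$\overline P_{hjk}=\tau P_{hjk}-\frac{\tau L}{2}\Big[L_{hjkr}D^r_{00}+L_{hjr}D^r_{0k}+L_{hkr}D^r_{0j}+L_{jkr}D^r_{0h}-\sigma_0L_{hjk}\Big].$$ -/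

import Mathlib

open scoped Manifold ContDiff

noncomputable section

namespace Finsler

/-! Local tensor calculus. A function `f x y` of a point `x = (x^i)` of a coordinate
domain and a tangent vector `y = (y^i)` at that point. -/

section Local

variable {n : ℕ}

/-- `∂_i f`, the partial derivative with respect to `x^i`. -/
def dX (i : Fin n) (f : EuclideanSpace ℝ (Fin n) → EuclideanSpace ℝ (Fin n) → ℝ)
    (x y : EuclideanSpace ℝ (Fin n)) : ℝ :=
  fderiv ℝ (fun x' => f x' y) x (EuclideanSpace.single i 1)

/-- `∂̇_i f`, the partial derivative with respect to `y^i`. -/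
def dY (i : Fin n) (f : EuclideanSpace ℝ (Fin n) → EuclideanSpace ℝ (Fin n) → ℝ)
    (x y : EuclideanSpace ℝ (Fin n)) : ℝ :=
  fderiv ℝ (fun y' => f x y') y (EuclideanSpace.single i 1)

variable (L : EuclideanSpace ℝ (Fin n) → EuclideanSpace ℝ (Fin n) → ℝ)

/-- The fundamental metric tensor `g_{ij} = ½ ∂̇_i ∂̇_j L²`. -/
def metric (x y : EuclideanSpace ℝ (Fin n)) : Matrix (Fin n) (Fin n) ℝ :=
  Matrix.of fun i j => (1 / 2 : ℝ) * dY i (dY j (fun x' y' => L x' y' ^ 2)) x y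

/-- The canonical spray coefficients
`S^i = ½ g^{il} (y^k ∂_k ∂̇_l L² - ∂_l L²)`; geodesics satisfy `ẍ^i + S^i(x, ẋ) = 0`. -/
def spray (i : Fin n) (x y : EuclideanSpace ℝ (Fin n)) : ℝ :=
  (1 / 2 : ℝ) * ∑ l, (metric L x y)⁻¹ i l *
    ((∑ k, y k * dX k (dY l (fun x' y' => L x' y' ^ 2)) x y)
      - dX l (fun x' y' => L x' y' ^ 2) x y)

/-- The canonical (Cartan) nonlinear connection `N^i_j = ½ ∂̇_j S^i`. -/
def nonlin (i j : Fin n) (x y : EuclideanSpace ℝ (Fin n)) : ℝ :=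
  (1 / 2 : ℝ) * dY j (spray L i) x y

/-- The horizontal derivation `δ_k f = ∂_k f - N^r_k ∂̇_r f`. -/
def dH (k : Fin n) (f : EuclideanSpace ℝ (Fin n) → EuclideanSpace ℝ (Fin n) → ℝ)
    (x y : EuclideanSpace ℝ (Fin n)) : ℝ :=
  dX k f x y - ∑ r, nonlin L r k x y * dY r f x y

/-- The horizontal coefficients of the Cartan connection,
`Γ^i_{jk} = ½ g^{il} (δ_j g_{lk} + δ_k g_{jl} - δ_l g_{jk})`. -/
def cartan (i j k : Fin n) (x y : EuclideanSpace ℝ (Fin n)) : ℝ :=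
  (1 / 2 : ℝ) * ∑ l, (metric L x y)⁻¹ i l *
    (dH L j (fun x' y' => metric L x' y' l k) x y
      + dH L k (fun x' y' => metric L x' y' j l) x y
      - dH L l (fun x' y' => metric L x' y' j k) x y)

/-- The (v)hv-torsion `P^i_{jk} = ∂̇_k N^i_j - Γ^i_{kj}` of the Cartan connection. -/
def torsionP (i j k : Fin n) (x y : EuclideanSpace ℝ (Fin n)) : ℝ :=
  dY k (nonlin L i j) x y - cartan L i k j x y

/-- The lowered (v)hv-torsion `P_{hjk} = g_{ih} P^i_{jk}`. -/
def torsionPLow (h j k : Fin n) (x y : EuclideanSpace ℝ (Fin n)) : ℝ :=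
  ∑ i, metric L x y i h * torsionP L i j k x y

/-- `L_{ijk} = ∂̇_k ∂̇_j ∂̇_i L`. -/
def L3 (i j k : Fin n) : EuclideanSpace ℝ (Fin n) → EuclideanSpace ℝ (Fin n) → ℝ :=
  dY k (dY j (dY i L))

/-- `L_{ijkl} = ∂̇_l ∂̇_k ∂̇_j ∂̇_i L`. -/
def L4 (i j k l : Fin n) : EuclideanSpace ℝ (Fin n) → EuclideanSpace ℝ (Fin n) → ℝ :=
  dY l (L3 L i j k)

variable (L' : EuclideanSpace ℝ (Fin n) → EuclideanSpace ℝ (Fin n) → ℝ)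

/-- The difference tensor `D^i_{jk}` of the Cartan connections of `L'` and `L`. -/
def diffTensor (i j k : Fin n) (x y : EuclideanSpace ℝ (Fin n)) : ℝ :=
  cartan L' i j k x y - cartan L i j k x y

/-- The contraction `D^i_{0k} = D^i_{jk} y^j`. -/
def diffTensor0 (i k : Fin n) (x y : EuclideanSpace ℝ (Fin n)) : ℝ :=
  ∑ j, diffTensor L L' i j k x y * y j

/-- The contraction `D^i_{00} = D^i_{jk} y^j y^k`. -/
def diffTensor00 (i : Fin n) (x y : EuclideanSpace ℝ (Fin n)) : ℝ :=
  ∑ j, ∑ k, diffTensor L L' i j k x y * y j * y k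

end Local

section Global

variable {n : ℕ} {M : Type*} [TopologicalSpace M] [ChartedSpace (EuclideanSpace ℝ (Fin n)) M]
  [IsManifold (𝓡 n) ∞ M]

/-- The expression of a function on the tangent bundle in the natural coordinates
`(x^i, y^i)` induced by a chart `e`: the point is `e⁻¹(x)`, the vector `y^i ∂/∂x^i`. -/
def inChart (e : OpenPartialHomeomorph M (EuclideanSpace ℝ (Fin n)))
    (F : TangentBundle (𝓡 n) M → ℝ) (x y : EuclideanSpace ℝ (Fin n)) : ℝ :=
  F ⟨e.symm x, mfderiv (𝓡 n) (𝓡 n) e.symm x y⟩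

/-- `L` is a Finsler metric function on the manifold `M`. -/
structure IsFinslerMetric (L : TangentBundle (𝓡 n) M → ℝ) : Prop where
  smooth : ContMDiffOn (𝓡 n).tangent 𝓘(ℝ, ℝ) ∞ L {v | v.2 ≠ 0}
  pos : ∀ v : TangentBundle (𝓡 n) M, v.2 ≠ 0 → 0 < L v
  homogeneous : ∀ (p : M) (v : TangentSpace (𝓡 n) p) (c : ℝ), 0 < c →
    L ⟨p, c • v⟩ = c * L ⟨p, v⟩
  posDef : ∀ e ∈ IsManifold.maximalAtlas (𝓡 n) ∞ M, ∀ x ∈ e.target,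
    ∀ y : EuclideanSpace ℝ (Fin n), y ≠ 0 → (metric (inChart e L) x y).PosDef

/-- The β-conformal change `L̄(x, y) = e^{σ(x)} L(x, y) + b_i(x) y^i`. -/
def betaConformal (L : TangentBundle (𝓡 n) M → ℝ) (σ : M → ℝ)
    (b : ∀ p : M, TangentSpace (𝓡 n) p →L[ℝ] ℝ) (v : TangentBundle (𝓡 n) M) : ℝ :=
  Real.exp (σ v.proj) * L v + b v.proj v.2

/-- `σ_0 = (∂σ/∂x^i) y^i` in the chart `e`. -/
def sigma0 (e : OpenPartialHomeomorph M (EuclideanSpace ℝ (Fin n))) (σ : M → ℝ)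
    (x y : EuclideanSpace ℝ (Fin n)) : ℝ :=
  ∑ i, fderiv ℝ (fun x' => σ (e.symm x')) x (EuclideanSpace.single i 1) * y i

end Global

end Finsler

end

/-! Since `L²`, and hence `L`, is horizontally constant, `∂_m L = N^i_m ∂̇_i L`
(`IsLocalFinsler.dX_eq`). Apply `∂̇_h ∂̇_j ∂̇_k` and contract with `y^m`. The Euler identities for
`N` turn the left side, `y^m ∂_m L_{hjk}`, into a sum of `L_{hjkr} S^r`, three terms of type
`L_{hjr} N^r_k`, and `-∂̇_h ∂̇_j N^i_k ∂̇_i L`; the terms with two vertical derivatives on `N`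
vanish. Lowering the Cartan coefficients shows that the last expression is `2 P_{hjk} / L`
(`torsionPLow_eq_landsberg`). Thus `P_{hjk}` is `L/2` times the horizontal derivative of `L_{hjk}`
along `y` (`torsionPLow_eq`), a formula linear in `S` and `N`.

The form `β` is linear in `y`, so `L̄_{hjk} = e^σ L_{hjk}` (`L3_betaConformal`). Subtracting the two
formulas leaves only `S̄ - S = D_{00}` and `N̄ - N = D_0`, by `Γ^i_{jk} y^j = N^i_k` and `N^i_j y^j
= S^i`, together with the `x`-derivative of `e^σ`, which gives `σ_0`. The precise form of `D` is
never needed. -/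

noncomputable section

namespace Finsler

/-! ### Smooth functions on the slit tangent bundle of a coordinate domain. -/

section Calculus

variable {n : ℕ}

/-- The slit tangent bundle `U × (ℝⁿ \ {0})` of a coordinate domain `U`. -/
def slit (U : Set (EuclideanSpace ℝ (Fin n))) :
    Set (EuclideanSpace ℝ (Fin n) × EuclideanSpace ℝ (Fin n)) :=
  U ×ˢ {0}ᶜ

/-- Smoothness of a function of `(x, y)` on the slit tangent bundle of `U`. -/
def SmoothOn (U : Set (EuclideanSpace ℝ (Fin n)))
    (f : EuclideanSpace ℝ (Fin n) → EuclideanSpace ℝ (Fin n) → ℝ) : Prop :=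
  ContDiffOn ℝ ∞ (Function.uncurry f) (slit U)

variable {U : Set (EuclideanSpace ℝ (Fin n))}
  {f g : EuclideanSpace ℝ (Fin n) → EuclideanSpace ℝ (Fin n) → ℝ}
  {x y : EuclideanSpace ℝ (Fin n)}

lemma isOpen_slit (hU : IsOpen U) : IsOpen (slit U) :=
  hU.prod isOpen_compl_singleton

lemma mk_mem_slit (hx : x ∈ U) (hy : y ≠ 0) : (x, y) ∈ slit U := ⟨hx, hy⟩

namespace SmoothOn

lemma contDiffAt (hf : SmoothOn U f) (hU : IsOpen U) (hx : x ∈ U) (hy : y ≠ 0) :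
    ContDiffAt ℝ ∞ (Function.uncurry f) (x, y) :=
  ContDiffOn.contDiffAt hf ((isOpen_slit hU).mem_nhds (mk_mem_slit hx hy))

lemma differentiableAt (hf : SmoothOn U f) (hU : IsOpen U) (hx : x ∈ U) (hy : y ≠ 0) :
    DifferentiableAt ℝ (Function.uncurry f) (x, y) :=
  (hf.contDiffAt hU hx hy).differentiableAt (by simp)

lemma differentiableAt_left (hf : SmoothOn U f) (hU : IsOpen U) (hx : x ∈ U) (hy : y ≠ 0) :
    DifferentiableAt ℝ (fun x' => f x' y) x :=
  (hf.differentiableAt hU hx hy).comp x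
    (f := fun x' => (x', y)) (by fun_prop)

lemma differentiableAt_right (hf : SmoothOn U f) (hU : IsOpen U) (hx : x ∈ U) (hy : y ≠ 0) :
    DifferentiableAt ℝ (fun y' => f x y') y :=
  (hf.differentiableAt hU hx hy).comp y
    (f := fun y' => (x, y')) (by fun_prop)

/-- Partial derivatives become values of one total derivative on the product, so smoothness and
symmetry of second derivatives can be quoted from there. -/
lemma dX_eq (hf : SmoothOn U f) (hU : IsOpen U) (hx : x ∈ U) (hy : y ≠ 0) (i : Fin n) :
    dX i f x y = fderiv ℝ (Function.uncurry f) (x, y) (EuclideanSpace.single i 1, 0) := by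
  have h := ((hf.differentiableAt hU hx hy).hasFDerivAt.comp x
    (f := fun x' => (x', y)) ((hasFDerivAt_id x).prodMk (hasFDerivAt_const y x))).fderiv
  simp only [dX]
  change fderiv ℝ (Function.uncurry f ∘ fun x' => (x', y)) x _ = _
  rw [h]
  simp

lemma dY_eq (hf : SmoothOn U f) (hU : IsOpen U) (hx : x ∈ U) (hy : y ≠ 0) (i : Fin n) :
    dY i f x y = fderiv ℝ (Function.uncurry f) (x, y) (0, EuclideanSpace.single i 1) := by
  have h := ((hf.differentiableAt hU hx hy).hasFDerivAt.comp y
    (f := fun y' => (x, y')) ((hasFDerivAt_const x y).prodMk (hasFDerivAt_id y))).fderiv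
  simp only [dY]
  change fderiv ℝ (Function.uncurry f ∘ fun y' => (x, y')) y _ = _
  rw [h]
  simp

lemma congr (hf : SmoothOn U f) (h : ∀ x ∈ U, ∀ y, y ≠ 0 → g x y = f x y) : SmoothOn U g :=
  ContDiffOn.congr hf fun p hp => h p.1 hp.1 p.2 hp.2

lemma fderiv_apply (hf : SmoothOn U f) (hU : IsOpen U)
    (v : EuclideanSpace ℝ (Fin n) × EuclideanSpace ℝ (Fin n)) :
    ContDiffOn ℝ ∞ (fun p => fderiv ℝ (Function.uncurry f) p v) (slit U) :=
  (ContDiffOn.fderiv_of_isOpen hf (isOpen_slit hU) (by simp)).clm_apply contDiffOn_const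

lemma dX (hf : SmoothOn U f) (hU : IsOpen U) (i : Fin n) : SmoothOn U (dX i f) :=
  (hf.fderiv_apply hU (EuclideanSpace.single i 1, 0)).congr
    fun _ hp => hf.dX_eq hU hp.1 hp.2 i

lemma dY (hf : SmoothOn U f) (hU : IsOpen U) (i : Fin n) : SmoothOn U (dY i f) :=
  (hf.fderiv_apply hU (0, EuclideanSpace.single i 1)).congr
    fun _ hp => hf.dY_eq hU hp.1 hp.2 i

lemma add (hf : SmoothOn U f) (hg : SmoothOn U g) : SmoothOn U (fun x y => f x y + g x y) :=
  ContDiffOn.add hf hg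

lemma sub (hf : SmoothOn U f) (hg : SmoothOn U g) : SmoothOn U (fun x y => f x y - g x y) :=
  ContDiffOn.sub hf hg

lemma mul (hf : SmoothOn U f) (hg : SmoothOn U g) : SmoothOn U (fun x y => f x y * g x y) :=
  ContDiffOn.mul hf hg

lemma pow (hf : SmoothOn U f) (m : ℕ) : SmoothOn U (fun x y => f x y ^ m) :=
  ContDiffOn.pow hf m

lemma inv (hf : SmoothOn U f) (h : ∀ x ∈ U, ∀ y, y ≠ 0 → f x y ≠ 0) :
    SmoothOn U (fun x y => (f x y)⁻¹) :=
  ContDiffOn.inv hf fun p hp => h p.1 hp.1 p.2 hp.2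

lemma sum {ι : Type*} {s : Finset ι}
    {F : ι → EuclideanSpace ℝ (Fin n) → EuclideanSpace ℝ (Fin n) → ℝ}
    (hF : ∀ i ∈ s, SmoothOn U (F i)) : SmoothOn U (fun x y => ∑ i ∈ s, F i x y) :=
  ContDiffOn.sum hF

lemma prod {ι : Type*} {s : Finset ι}
    {F : ι → EuclideanSpace ℝ (Fin n) → EuclideanSpace ℝ (Fin n) → ℝ}
    (hF : ∀ i ∈ s, SmoothOn U (F i)) : SmoothOn U (fun x y => ∏ i ∈ s, F i x y) :=
  contDiffOn_prod hF

lemma const (c : ℝ) : SmoothOn U (fun _ _ => c) := contDiffOn_const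

lemma const_mul (hf : SmoothOn U f) (c : ℝ) : SmoothOn U (fun x y => c * f x y) :=
  (const c).mul hf

lemma coord (k : Fin n) : SmoothOn U (fun _ y => y k) := by
  have : ContDiff ℝ ∞ (fun p : EuclideanSpace ℝ (Fin n) × EuclideanSpace ℝ (Fin n) => p.2 k) := by
    fun_prop
  exact this.contDiffOn

lemma det {m : Type*} [Fintype m] [DecidableEq m]
    {A : EuclideanSpace ℝ (Fin n) → EuclideanSpace ℝ (Fin n) → Matrix m m ℝ}
    (hA : ∀ i j, SmoothOn U (fun x y => A x y i j)) : SmoothOn U (fun x y => (A x y).det) := by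
  simp only [Matrix.det_apply']
  exact sum fun τ _ => (const _).mul (prod fun i _ => hA _ _)

/-- Cramer's rule: the adjugate is polynomial in the entries and the determinant does not vanish. -/
lemma matrix_inv {m : Type*} [Fintype m] [DecidableEq m]
    {A : EuclideanSpace ℝ (Fin n) → EuclideanSpace ℝ (Fin n) → Matrix m m ℝ}
    (hA : ∀ i j, SmoothOn U (fun x y => A x y i j))
    (hdet : ∀ x ∈ U, ∀ y, y ≠ 0 → (A x y).det ≠ 0) (i j : m) :
    SmoothOn U (fun x y => (A x y)⁻¹ i j) := by
  simp only [Matrix.inv_def, Matrix.smul_apply, Ring.inverse_eq_inv', smul_eq_mul,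
    Matrix.adjugate_apply]
  refine ((det hA).inv hdet).mul (det fun k l => ?_)
  simp only [Matrix.updateRow_apply]
  split_ifs
  · exact const _
  · exact hA k l

end SmoothOn

/-! ### Differentiation rules for `∂_i` and `∂̇_i`. -/

section Rules

/-- Identities hold only over `U` and off the zero section; both conditions are open, so such
identities may still be differentiated. -/
lemma dX_congr (hU : IsOpen U) (h : ∀ x ∈ U, ∀ y, y ≠ 0 → f x y = g x y) (hx : x ∈ U)
    (hy : y ≠ 0) (i : Fin n) : dX i f x y = dX i g x y := by
  have : (fun x' => f x' y) =ᶠ[nhds x] fun x' => g x' y :=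
    Filter.eventuallyEq_of_mem (hU.mem_nhds hx) fun x' hx' => h x' hx' y hy
  simp only [dX, this.fderiv_eq]

lemma dY_congr (h : ∀ x ∈ U, ∀ y, y ≠ 0 → f x y = g x y) (hx : x ∈ U)
    (hy : y ≠ 0) (i : Fin n) : dY i f x y = dY i g x y := by
  have : (fun y' => f x y') =ᶠ[nhds y] fun y' => g x y' :=
    Filter.eventuallyEq_of_mem (isOpen_compl_singleton.mem_nhds hy) fun y' hy' => h x hx y' hy'
  simp only [dY, this.fderiv_eq]


lemma dX_mul (hU : IsOpen U) (hf : SmoothOn U f) (hg : SmoothOn U g) (hx : x ∈ U) (hy : y ≠ 0)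
    (i : Fin n) :
    dX i (fun x y => f x y * g x y) x y = dX i f x y * g x y + f x y * dX i g x y := by
  simp only [dX]
  rw [fderiv_fun_mul (hf.differentiableAt_left hU hx hy) (hg.differentiableAt_left hU hx hy)]
  simp
  ring

lemma dX_const_mul (hU : IsOpen U) (hf : SmoothOn U f) (hx : x ∈ U) (hy : y ≠ 0)
    (c : ℝ) (i : Fin n) : dX i (fun x y => c * f x y) x y = c * dX i f x y := by
  simp only [dX]
  rw [fderiv_const_mul (hf.differentiableAt_left hU hx hy)]
  simp

lemma dX_sum (hU : IsOpen U) {ι : Type*} {s : Finset ι}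
    {F : ι → EuclideanSpace ℝ (Fin n) → EuclideanSpace ℝ (Fin n) → ℝ}
    (hF : ∀ k ∈ s, SmoothOn U (F k)) (hx : x ∈ U) (hy : y ≠ 0) (i : Fin n) :
    dX i (fun x y => ∑ k ∈ s, F k x y) x y = ∑ k ∈ s, dX i (F k) x y := by
  simp only [dX]
  rw [fderiv_fun_sum fun k hk => (hF k hk).differentiableAt_left hU hx hy]
  simp

lemma dX_sum_mul (hU : IsOpen U) {ι : Type*} {s : Finset ι}
    {F G : ι → EuclideanSpace ℝ (Fin n) → EuclideanSpace ℝ (Fin n) → ℝ}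
    (hF : ∀ k, SmoothOn U (F k)) (hG : ∀ k, SmoothOn U (G k)) (hx : x ∈ U) (hy : y ≠ 0)
    (i : Fin n) :
    dX i (fun x y => ∑ k ∈ s, F k x y * G k x y) x y =
      ∑ k ∈ s, (dX i (F k) x y * G k x y + F k x y * dX i (G k) x y) := by
  rw [dX_sum hU (fun k _ => (hF k).mul (hG k)) hx hy]
  exact Finset.sum_congr rfl fun k _ => dX_mul hU (hF k) (hG k) hx hy i

lemma dY_mul (hU : IsOpen U) (hf : SmoothOn U f) (hg : SmoothOn U g) (hx : x ∈ U) (hy : y ≠ 0)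
    (i : Fin n) :
    dY i (fun x y => f x y * g x y) x y = dY i f x y * g x y + f x y * dY i g x y := by
  simp only [dY]
  rw [fderiv_fun_mul (hf.differentiableAt_right hU hx hy) (hg.differentiableAt_right hU hx hy)]
  simp
  ring

lemma dY_const_mul (hU : IsOpen U) (hf : SmoothOn U f) (hx : x ∈ U) (hy : y ≠ 0)
    (c : ℝ) (i : Fin n) : dY i (fun x y => c * f x y) x y = c * dY i f x y := by
  simp only [dY]
  rw [fderiv_const_mul (hf.differentiableAt_right hU hx hy)]
  simp

lemma dY_add (hU : IsOpen U) (hf : SmoothOn U f) (hg : SmoothOn U g) (hx : x ∈ U) (hy : y ≠ 0)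
    (i : Fin n) : dY i (fun x y => f x y + g x y) x y = dY i f x y + dY i g x y := by
  simp only [dY]
  rw [fderiv_fun_add (hf.differentiableAt_right hU hx hy) (hg.differentiableAt_right hU hx hy)]
  simp

lemma dY_sub (hU : IsOpen U) (hf : SmoothOn U f) (hg : SmoothOn U g) (hx : x ∈ U) (hy : y ≠ 0)
    (i : Fin n) : dY i (fun x y => f x y - g x y) x y = dY i f x y - dY i g x y := by
  simp only [dY]
  rw [fderiv_fun_sub (hf.differentiableAt_right hU hx hy) (hg.differentiableAt_right hU hx hy)]
  simp

lemma dY_sum (hU : IsOpen U) {ι : Type*} {s : Finset ι}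
    {F : ι → EuclideanSpace ℝ (Fin n) → EuclideanSpace ℝ (Fin n) → ℝ}
    (hF : ∀ k ∈ s, SmoothOn U (F k)) (hx : x ∈ U) (hy : y ≠ 0) (i : Fin n) :
    dY i (fun x y => ∑ k ∈ s, F k x y) x y = ∑ k ∈ s, dY i (F k) x y := by
  simp only [dY]
  rw [fderiv_fun_sum fun k hk => (hF k hk).differentiableAt_right hU hx hy]
  simp

lemma dY_sum_mul (hU : IsOpen U) {ι : Type*} {s : Finset ι}
    {F G : ι → EuclideanSpace ℝ (Fin n) → EuclideanSpace ℝ (Fin n) → ℝ}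
    (hF : ∀ k, SmoothOn U (F k)) (hG : ∀ k, SmoothOn U (G k)) (hx : x ∈ U) (hy : y ≠ 0)
    (i : Fin n) :
    dY i (fun x y => ∑ k ∈ s, F k x y * G k x y) x y =
      ∑ k ∈ s, (dY i (F k) x y * G k x y + F k x y * dY i (G k) x y) := by
  rw [dY_sum hU (fun k _ => (hF k).mul (hG k)) hx hy]
  exact Finset.sum_congr rfl fun k _ => dY_mul hU (hF k) (hG k) hx hy i

lemma dX_coord (i k : Fin n) : dX i (fun _ y => y k) x y = 0 := by
  simp [dX]

lemma dY_coord (i k : Fin n) : dY i (fun _ y => y k) x y = if k = i then 1 else 0 := by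
  have h : (fun y : EuclideanSpace ℝ (Fin n) => y k) =
      (EuclideanSpace.proj k : EuclideanSpace ℝ (Fin n) →L[ℝ] ℝ) := by
    ext; simp
  simp only [dY, h, ContinuousLinearMap.fderiv]
  simp

lemma dX_sum_coord_mul (hU : IsOpen U)
    {F : Fin n → EuclideanSpace ℝ (Fin n) → EuclideanSpace ℝ (Fin n) → ℝ}
    (hF : ∀ k, SmoothOn U (F k)) (hx : x ∈ U) (hy : y ≠ 0) (i : Fin n) :
    dX i (fun x y => ∑ k, y k * F k x y) x y = ∑ k, y k * dX i (F k) x y := by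
  rw [dX_sum_mul hU (F := fun k _ y => y k) SmoothOn.coord hF hx hy]
  simp [dX_coord]

/-- The extra term `F i` comes from differentiating the coordinate `y^i`. It is what lowers the
degree each time an Euler identity is differentiated. -/
lemma dY_sum_coord_mul (hU : IsOpen U)
    {F : Fin n → EuclideanSpace ℝ (Fin n) → EuclideanSpace ℝ (Fin n) → ℝ}
    (hF : ∀ k, SmoothOn U (F k)) (hx : x ∈ U) (hy : y ≠ 0) (i : Fin n) :
    dY i (fun x y => ∑ k, y k * F k x y) x y = F i x y + ∑ k, y k * dY i (F k) x y := by
  rw [dY_sum_mul hU (F := fun k _ y => y k) SmoothOn.coord hF hx hy]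
  simp [dY_coord, Finset.sum_add_distrib]

namespace SmoothOn

/-- Schwarz's theorem on the product, the common source of both commutation rules below. -/
lemma fderiv_fderiv_apply (hf : SmoothOn U f) (hU : IsOpen U) (hx : x ∈ U) (hy : y ≠ 0)
    (v w : EuclideanSpace ℝ (Fin n) × EuclideanSpace ℝ (Fin n)) :
    fderiv ℝ (fun p => fderiv ℝ (Function.uncurry f) p w) (x, y) v =
      fderiv ℝ (fun p => fderiv ℝ (Function.uncurry f) p v) (x, y) w := by
  have hd : DifferentiableAt ℝ (fderiv ℝ (Function.uncurry f)) (x, y) :=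
    ((hf.contDiffAt hU hx hy).fderiv_right (m := 1) (by norm_cast)).differentiableAt (by simp)
  have hs := (hf.contDiffAt hU hx hy).isSymmSndFDerivAt
    (by rw [minSmoothness_of_isRCLikeNormedField]; norm_cast)
  have key : ∀ v w, fderiv ℝ (fun p => fderiv ℝ (Function.uncurry f) p w) (x, y) v =
      fderiv ℝ (fderiv ℝ (Function.uncurry f)) (x, y) v w := fun v w => by
    rw [fderiv_clm_apply hd (differentiableAt_const w)]
    simp
  rw [key, key]
  exact hs v w

lemma fderiv_uncurry_dX (hf : SmoothOn U f) (hU : IsOpen U) (hx : x ∈ U) (hy : y ≠ 0)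
    (i : Fin n) : fderiv ℝ (Function.uncurry (Finsler.dX i f)) (x, y) =
      fderiv ℝ (fun p => fderiv ℝ (Function.uncurry f) p (EuclideanSpace.single i 1, 0))
        (x, y) :=
  (Filter.eventuallyEq_of_mem ((isOpen_slit hU).mem_nhds (mk_mem_slit hx hy))
    fun _ hp => hf.dX_eq hU hp.1 hp.2 i).fderiv_eq

lemma fderiv_uncurry_dY (hf : SmoothOn U f) (hU : IsOpen U) (hx : x ∈ U) (hy : y ≠ 0)
    (i : Fin n) : fderiv ℝ (Function.uncurry (Finsler.dY i f)) (x, y) =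
      fderiv ℝ (fun p => fderiv ℝ (Function.uncurry f) p (0, EuclideanSpace.single i 1))
        (x, y) :=
  (Filter.eventuallyEq_of_mem ((isOpen_slit hU).mem_nhds (mk_mem_slit hx hy))
    fun _ hp => hf.dY_eq hU hp.1 hp.2 i).fderiv_eq

lemma dY_dY_comm (hf : SmoothOn U f) (hU : IsOpen U) (hx : x ∈ U) (hy : y ≠ 0)
    (i j : Fin n) : Finsler.dY i (Finsler.dY j f) x y = Finsler.dY j (Finsler.dY i f) x y := by
  rw [(hf.dY hU j).dY_eq hU hx hy, (hf.dY hU i).dY_eq hU hx hy, hf.fderiv_uncurry_dY hU hx hy,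
    hf.fderiv_uncurry_dY hU hx hy, hf.fderiv_fderiv_apply hU hx hy]

lemma dX_dY_comm (hf : SmoothOn U f) (hU : IsOpen U) (hx : x ∈ U) (hy : y ≠ 0)
    (i j : Fin n) : Finsler.dX i (Finsler.dY j f) x y = Finsler.dY j (Finsler.dX i f) x y := by
  rw [(hf.dY hU j).dX_eq hU hx hy, (hf.dX hU i).dY_eq hU hx hy, hf.fderiv_uncurry_dY hU hx hy,
    hf.fderiv_uncurry_dX hU hx hy, hf.fderiv_fderiv_apply hU hx hy]

end SmoothOn

lemma dY_dY_sum_mul (hU : IsOpen U) {ι : Type*} {s : Finset ι}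
    {F G : ι → EuclideanSpace ℝ (Fin n) → EuclideanSpace ℝ (Fin n) → ℝ}
    (hF : ∀ k, SmoothOn U (F k)) (hG : ∀ k, SmoothOn U (G k)) (hx : x ∈ U) (hy : y ≠ 0)
    (i j : Fin n) :
    dY i (dY j (fun x y => ∑ k ∈ s, F k x y * G k x y)) x y =
      ∑ k ∈ s, (dY i (dY j (F k)) x y * G k x y + dY j (F k) x y * dY i (G k) x y
        + dY i (F k) x y * dY j (G k) x y + F k x y * dY i (dY j (G k)) x y) := by
  rw [dY_congr (fun x hx y hy => dY_sum_mul hU hF hG hx hy j) hx hy,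
    dY_sum hU (fun k _ => (((hF k).dY hU j).mul (hG k)).add ((hF k).mul ((hG k).dY hU j))) hx hy]
  refine Finset.sum_congr rfl fun k _ => ?_
  rw [dY_add hU (((hF k).dY hU j).mul (hG k)) ((hF k).mul ((hG k).dY hU j)) hx hy,
    dY_mul hU ((hF k).dY hU j) (hG k) hx hy, dY_mul hU (hF k) ((hG k).dY hU j) hx hy]
  ring

lemma dY_dY_dY_sum_mul (hU : IsOpen U) {ι : Type*} {s : Finset ι}
    {F G : ι → EuclideanSpace ℝ (Fin n) → EuclideanSpace ℝ (Fin n) → ℝ}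
    (hF : ∀ k, SmoothOn U (F k)) (hG : ∀ k, SmoothOn U (G k)) (hx : x ∈ U) (hy : y ≠ 0)
    (i j l : Fin n) :
    dY i (dY j (dY l (fun x y => ∑ k ∈ s, F k x y * G k x y))) x y =
      ∑ k ∈ s, (dY i (dY j (dY l (F k))) x y * G k x y
        + dY j (dY l (F k)) x y * dY i (G k) x y + dY i (dY l (F k)) x y * dY j (G k) x y
        + dY i (dY j (F k)) x y * dY l (G k) x y + dY l (F k) x y * dY i (dY j (G k)) x y
        + dY j (F k) x y * dY i (dY l (G k)) x y + dY i (F k) x y * dY j (dY l (G k)) x y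
        + F k x y * dY i (dY j (dY l (G k))) x y) := by
  have h1 : ∀ k, SmoothOn U fun x y => dY l (F k) x y * G k x y :=
    fun k => ((hF k).dY hU l).mul (hG k)
  have h2 : ∀ k, SmoothOn U fun x y => F k x y * dY l (G k) x y :=
    fun k => (hF k).mul ((hG k).dY hU l)
  have e : ∀ x ∈ U, ∀ y, y ≠ 0 → dY l (fun x y => ∑ k ∈ s, F k x y * G k x y) x y =
      (∑ k ∈ s, dY l (F k) x y * G k x y) + ∑ k ∈ s, F k x y * dY l (G k) x y :=
    fun x hx y hy => by rw [dY_sum_mul hU hF hG hx hy l, Finset.sum_add_distrib]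
  have e' : ∀ x ∈ U, ∀ y, y ≠ 0 →
      dY j (dY l (fun x y => ∑ k ∈ s, F k x y * G k x y)) x y =
      dY j (fun x y => ∑ k ∈ s, dY l (F k) x y * G k x y) x y +
        dY j (fun x y => ∑ k ∈ s, F k x y * dY l (G k) x y) x y :=
    fun x hx y hy => by
      rw [dY_congr e hx hy, dY_add hU (.sum fun k _ => h1 k) (.sum fun k _ => h2 k) hx hy]
  rw [dY_congr e' hx hy, dY_add hU ((SmoothOn.sum fun k _ => h1 k).dY hU j)
      ((SmoothOn.sum fun k _ => h2 k).dY hU j) hx hy,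
    dY_dY_sum_mul hU (fun k => (hF k).dY hU l) hG hx hy,
    dY_dY_sum_mul hU hF (fun k => (hG k).dY hU l) hx hy, ← Finset.sum_add_distrib]
  exact Finset.sum_congr rfl fun k _ => by ring

end Rules

end Calculus

end Finsler

end

noncomputable section

namespace Finsler

/-! ### Finsler metrics over a coordinate domain. -/

section LocalFinsler

variable {n : ℕ}

/-- A Finsler metric function in the natural coordinates over a coordinate domain `U`. -/
structure IsLocalFinsler (U : Set (EuclideanSpace ℝ (Fin n)))
    (L : EuclideanSpace ℝ (Fin n) → EuclideanSpace ℝ (Fin n) → ℝ) : Prop where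
  isOpen : IsOpen U
  smooth : SmoothOn U L
  pos : ∀ x ∈ U, ∀ y, y ≠ 0 → 0 < L x y
  homogeneous : ∀ x ∈ U, ∀ y, y ≠ 0 → ∀ c : ℝ, 0 < c → L x (c • y) = c * L x y
  posDef : ∀ x ∈ U, ∀ y, y ≠ 0 → (metric L x y).PosDef

namespace IsLocalFinsler

/-- The square `L²`. -/
abbrev sq (L : EuclideanSpace ℝ (Fin n) → EuclideanSpace ℝ (Fin n) → ℝ) :
    EuclideanSpace ℝ (Fin n) → EuclideanSpace ℝ (Fin n) → ℝ :=
  fun x' y' => L x' y' ^ 2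

variable {U : Set (EuclideanSpace ℝ (Fin n))}
  {L : EuclideanSpace ℝ (Fin n) → EuclideanSpace ℝ (Fin n) → ℝ}
  {x y : EuclideanSpace ℝ (Fin n)}

lemma metric_apply (i j : Fin n) :
    metric L x y i j = (1 / 2 : ℝ) * dY i (dY j (sq L)) x y := rfl

lemma smooth_sq (H : IsLocalFinsler U L) : SmoothOn U (sq L) := H.smooth.pow 2

lemma smooth_metric (H : IsLocalFinsler U L) (i j : Fin n) :
    SmoothOn U (fun x y => metric L x y i j) :=
  ((H.smooth_sq.dY H.isOpen j).dY H.isOpen i).const_mul _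

lemma det_metric_ne_zero (H : IsLocalFinsler U L) (hx : x ∈ U) (hy : y ≠ 0) :
    (metric L x y).det ≠ 0 :=
  (H.posDef x hx y hy).det_pos.ne'

lemma smooth_metric_inv (H : IsLocalFinsler U L) (i j : Fin n) :
    SmoothOn U (fun x y => (metric L x y)⁻¹ i j) :=
  SmoothOn.matrix_inv H.smooth_metric (fun _ hx _ hy => H.det_metric_ne_zero hx hy) i j

lemma smooth_spray (H : IsLocalFinsler U L) (i : Fin n) : SmoothOn U (spray L i) :=
  (SmoothOn.sum fun l _ => (H.smooth_metric_inv i l).mul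
    ((SmoothOn.sum fun k _ => (SmoothOn.coord k).mul
      ((H.smooth_sq.dY H.isOpen l).dX H.isOpen k)).sub
        (H.smooth_sq.dX H.isOpen l))).const_mul _

lemma smooth_nonlin (H : IsLocalFinsler U L) (i j : Fin n) : SmoothOn U (nonlin L i j) :=
  ((H.smooth_spray i).dY H.isOpen j).const_mul _

lemma metric_comm (H : IsLocalFinsler U L) (hx : x ∈ U) (hy : y ≠ 0) (i j : Fin n) :
    metric L x y i j = metric L x y j i := by
  rw [metric_apply, metric_apply, H.smooth_sq.dY_dY_comm H.isOpen hx hy]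

lemma sum_metric_mul_inv (H : IsLocalFinsler U L) (hx : x ∈ U) (hy : y ≠ 0)
    (X : Fin n → ℝ) (h : Fin n) :
    ∑ i, metric L x y i h * ∑ l, (metric L x y)⁻¹ i l * X l = X h := by
  have h1 : (metric L x y).mulVec ((metric L x y)⁻¹.mulVec X) = X := by
    rw [Matrix.mulVec_mulVec, Matrix.mul_nonsing_inv _ (H.det_metric_ne_zero hx hy).isUnit,
      Matrix.one_mulVec]
  have h2 := congrFun h1 h
  simp only [Matrix.mulVec, dotProduct] at h2
  rw [← h2]
  exact Finset.sum_congr rfl fun i _ => by rw [H.metric_comm hx hy]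

/-- The metric is nonsingular, so vectors can be compared through their lowered components, where no
inverse matrix appears. -/
lemma eq_of_sum_metric_mul_eq (H : IsLocalFinsler U L) (hx : x ∈ U) (hy : y ≠ 0)
    {v w : Fin n → ℝ}
    (h : ∀ l, ∑ i, metric L x y i l * v i = ∑ i, metric L x y i l * w i) : v = w := by
  refine Matrix.mulVec_injective_of_isUnit (A := metric L x y)
    ((Matrix.isUnit_iff_isUnit_det _).2 (H.det_metric_ne_zero hx hy).isUnit) (funext fun l => ?_)
  simp only [Matrix.mulVec, dotProduct]
  simpa only [H.metric_comm hx hy l] using h l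

/-! ### Euler identities for `L`, `L²` and their derivatives. -/

/-- Euler's theorem for `L`. -/
lemma euler (H : IsLocalFinsler U L) (hx : x ∈ U) (hy : y ≠ 0) :
    ∑ k, y k * dY k L x y = L x y := by
  have hd := H.smooth.differentiableAt_right H.isOpen hx hy
  have h1 : HasDerivAt (fun c : ℝ => L x (c • y)) (fderiv ℝ (fun y' => L x y') y y) 1 := by
    have hs : HasDerivAt (fun c : ℝ => c • y) y 1 := by
      simpa using (hasDerivAt_id (1 : ℝ)).smul_const y
    have hd' : HasFDerivAt (fun y' => L x y') (fderiv ℝ (fun y' => L x y') y) ((1 : ℝ) • y) := by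
      simpa using hd.hasFDerivAt
    exact hd'.comp_hasDerivAt 1 hs
  -- Homogeneity makes the function linear in `c` for `c > 0`, hence near `c = 1`; uniqueness of the
  -- derivative then gives Euler's identity.
  have h2 : HasDerivAt (fun c : ℝ => L x (c • y)) (L x y) 1 := by
    have : HasDerivAt (fun c : ℝ => c * L x y) (L x y) 1 := by
      simpa using (hasDerivAt_id (1 : ℝ)).mul_const (L x y)
    refine this.congr_of_eventuallyEq ?_
    filter_upwards [lt_mem_nhds (zero_lt_one (α := ℝ))] with c hc
    exact H.homogeneous x hx y hy c hc
  rw [← h1.unique h2]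
  have hsum : ∑ k, y k • EuclideanSpace.single k (1 : ℝ) = y := by
    ext i
    simp [Finset.sum_apply, Pi.single_apply]
  have h3 := congrArg (fderiv ℝ (fun y' => L x y') y) hsum
  simpa only [map_sum, map_smul, smul_eq_mul, dY] using h3

lemma dY_sq (H : IsLocalFinsler U L) (hx : x ∈ U) (hy : y ≠ 0) (k : Fin n) :
    dY k (sq L) x y = 2 * L x y * dY k L x y := by
  have e : sq L = fun x y => L x y * L x y := by funext x y; exact pow_two _
  rw [e, dY_mul H.isOpen H.smooth H.smooth hx hy]
  ring

lemma dX_sq (H : IsLocalFinsler U L) (hx : x ∈ U) (hy : y ≠ 0) (k : Fin n) :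
    dX k (sq L) x y = 2 * L x y * dX k L x y := by
  have e : sq L = fun x y => L x y * L x y := by funext x y; exact pow_two _
  rw [e, dX_mul H.isOpen H.smooth H.smooth hx hy]
  ring

lemma euler_sq (H : IsLocalFinsler U L) (hx : x ∈ U) (hy : y ≠ 0) :
    ∑ k, y k * dY k (sq L) x y = 2 * sq L x y := by
  simp only [H.dY_sq hx hy, sq]
  calc _ = 2 * L x y * ∑ k, y k * dY k L x y := by
        rw [Finset.mul_sum]; exact Finset.sum_congr rfl fun k _ => by ring
    _ = _ := by rw [H.euler hx hy]; ring

lemma euler_dX_sq (H : IsLocalFinsler U L) (hx : x ∈ U) (hy : y ≠ 0) (j : Fin n) :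
    ∑ k, y k * dX j (dY k (sq L)) x y = 2 * dX j (sq L) x y := by
  rw [← dX_sum_coord_mul H.isOpen (fun k => H.smooth_sq.dY H.isOpen k) hx hy,
    dX_congr H.isOpen (fun x hx y hy => H.euler_sq hx hy) hx hy,
    dX_const_mul H.isOpen H.smooth_sq hx hy]

lemma euler_dY_sq (H : IsLocalFinsler U L) (hx : x ∈ U) (hy : y ≠ 0) (l : Fin n) :
    ∑ k, y k * dY k (dY l (sq L)) x y = dY l (sq L) x y := by
  have h := dY_sum_coord_mul H.isOpen (fun k => H.smooth_sq.dY H.isOpen k) hx hy l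
  rw [dY_congr (fun x hx y hy => H.euler_sq hx hy) hx hy,
    dY_const_mul H.isOpen H.smooth_sq hx hy] at h
  simp only [H.smooth_sq.dY_dY_comm H.isOpen hx hy _ l]
  linarith

lemma euler_dX_dY_sq (H : IsLocalFinsler U L) (hx : x ∈ U) (hy : y ≠ 0) (j l : Fin n) :
    ∑ k, y k * dX j (dY k (dY l (sq L))) x y = dX j (dY l (sq L)) x y := by
  rw [← dX_sum_coord_mul H.isOpen (fun k => (H.smooth_sq.dY H.isOpen l).dY H.isOpen k) hx hy,
    dX_congr H.isOpen (fun x hx y hy => H.euler_dY_sq hx hy l) hx hy]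

lemma dX_dY_dY_sq_comm (H : IsLocalFinsler U L) (hx : x ∈ U) (hy : y ≠ 0) (j k l : Fin n) :
    dX j (dY k (dY l (sq L))) x y = dX j (dY l (dY k (sq L))) x y :=
  dX_congr H.isOpen (fun _ hx _ hy => H.smooth_sq.dY_dY_comm H.isOpen hx hy k l) hx hy j

lemma dY_dY_dY_comm_left {f : EuclideanSpace ℝ (Fin n) → EuclideanSpace ℝ (Fin n) → ℝ}
    (hU : IsOpen U) (hf : SmoothOn U f) (hx : x ∈ U) (hy : y ≠ 0) (j k l : Fin n) :
    dY j (dY k (dY l f)) x y = dY j (dY l (dY k f)) x y :=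
  dY_congr (fun _ hx _ hy => hf.dY_dY_comm hU hx hy k l) hx hy j

lemma euler_dY_dY_sq (H : IsLocalFinsler U L) (hx : x ∈ U) (hy : y ≠ 0) (j l : Fin n) :
    ∑ k, y k * dY j (dY k (dY l (sq L))) x y = 0 := by
  have h := dY_sum_coord_mul H.isOpen
    (fun k => (H.smooth_sq.dY H.isOpen l).dY H.isOpen k) hx hy j
  rw [dY_congr (fun x hx y hy => H.euler_dY_sq hx hy l) hx hy] at h
  linarith

/-- `∂̇_j g_{il}` is half a third vertical derivative of `L²`, a function of degree 2, so it is
annihilated by `y`. -/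
lemma sum_dY_metric_mul_left (H : IsLocalFinsler U L) (hx : x ∈ U) (hy : y ≠ 0) (j i : Fin n) :
    ∑ l, y l * dY j (fun x y => metric L x y i l) x y = 0 := by
  have e : ∀ l, dY j (fun x y => metric L x y i l) x y =
      (1 / 2 : ℝ) * dY j (dY l (dY i (sq L))) x y := fun l => by
    rw [← dY_dY_dY_comm_left H.isOpen H.smooth_sq hx hy]
    exact dY_const_mul H.isOpen ((H.smooth_sq.dY H.isOpen l).dY H.isOpen i) hx hy _ _
  have := H.euler_dY_dY_sq hx hy j i
  simp only [e]
  calc _ = (1 / 2 : ℝ) * ∑ l, y l * dY j (dY l (dY i (sq L))) x y := by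
        rw [Finset.mul_sum]; exact Finset.sum_congr rfl fun k _ => by ring
    _ = 0 := by rw [this]; ring

lemma sum_dY_metric_mul (H : IsLocalFinsler U L) (hx : x ∈ U) (hy : y ≠ 0) (i l : Fin n) :
    ∑ j, y j * dY j (fun x y => metric L x y i l) x y = 0 := by
  rw [← H.sum_dY_metric_mul_left hx hy i l]
  refine Finset.sum_congr rfl fun j _ => ?_
  have hs := fun a b => (H.smooth_sq.dY H.isOpen b).dY H.isOpen a
  have e1 : dY j (fun x y => metric L x y i l) x y =
      (1 / 2 : ℝ) * dY j (dY i (dY l (sq L))) x y :=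
    dY_const_mul H.isOpen (hs i l) hx hy _ _
  have e2 : dY i (fun x y => metric L x y l j) x y =
      (1 / 2 : ℝ) * dY i (dY l (dY j (sq L))) x y :=
    dY_const_mul H.isOpen (hs l j) hx hy _ _
  rw [e1, e2, (H.smooth_sq.dY H.isOpen l).dY_dY_comm H.isOpen hx hy,
    dY_dY_dY_comm_left H.isOpen H.smooth_sq hx hy]

lemma sum_mul_metric (H : IsLocalFinsler U L) (hx : x ∈ U) (hy : y ≠ 0) (i : Fin n) :
    ∑ l, y l * metric L x y i l = (1 / 2 : ℝ) * dY i (sq L) x y := by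
  rw [← H.euler_dY_sq hx hy i, Finset.mul_sum]
  exact Finset.sum_congr rfl fun l _ => by rw [H.metric_comm hx hy, metric_apply]; ring

/-! ### The spray and the nonlinear connection. -/

/-- The defining equation of the canonical spray, with the index lowered. -/
lemma sum_metric_mul_spray (H : IsLocalFinsler U L) (hx : x ∈ U) (hy : y ≠ 0) (l : Fin n) :
    ∑ i, metric L x y i l * spray L i x y =
      (1 / 2 : ℝ) * ((∑ k, y k * dX k (dY l (sq L)) x y) - dX l (sq L) x y) := by
  rw [← H.sum_metric_mul_inv hx hy
    (fun l => (∑ k, y k * dX k (dY l (sq L)) x y) - dX l (sq L) x y) l, Finset.mul_sum]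
  exact Finset.sum_congr rfl fun i _ => by rw [spray]; ring

/-- This is `∂̇_j` of the lowered spray equation. Contracting it with `y^j` gives `N^i_j y^j = S^i`;
contracting it with `y^l` gives `δ_j L² = 0`. -/
lemma sum_metric_mul_nonlin (H : IsLocalFinsler U L) (hx : x ∈ U) (hy : y ≠ 0) (j l : Fin n) :
    (∑ i, dY j (fun x y => metric L x y i l) x y * spray L i x y)
      + 2 * ∑ i, metric L x y i l * nonlin L i j x y =
      (1 / 2 : ℝ) * (dX j (dY l (sq L)) x y + (∑ k, y k * dX k (dY j (dY l (sq L))) x y)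
        - dX l (dY j (sq L)) x y) := by
  have hQ := H.smooth_sq
  have hU := H.isOpen
  have hA := fun k => (hQ.dY hU l).dX hU k
  have h := dY_sum_mul hU (fun i => H.smooth_metric i l) (fun i => H.smooth_spray i) hx hy
    (s := Finset.univ) j
  rw [dY_congr (fun x hx y hy => H.sum_metric_mul_spray hx hy l) hx hy,
    dY_const_mul hU ((SmoothOn.sum fun k _ => (SmoothOn.coord k).mul (hA k)).sub (hQ.dX hU l))
      hx hy,
    dY_sub hU (SmoothOn.sum fun k _ => (SmoothOn.coord k).mul (hA k)) (hQ.dX hU l) hx hy,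
    dY_sum_coord_mul hU hA hx hy, Finset.sum_add_distrib, ← hQ.dX_dY_comm hU hx hy] at h
  simp only [(hQ.dY hU l).dX_dY_comm hU hx hy]
  rw [h, Finset.mul_sum]
  congr 1
  exact Finset.sum_congr rfl fun i _ => by rw [nonlin]; ring

/-- `N^i_j y^j = S^i`. -/
lemma sum_nonlin_mul (H : IsLocalFinsler U L) (hx : x ∈ U) (hy : y ≠ 0) (i : Fin n) :
    ∑ j, y j * nonlin L i j x y = spray L i x y := by
  refine congrFun (f := fun i => ∑ j, y j * nonlin L i j x y) (g := fun i => spray L i x y)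
    (H.eq_of_sum_metric_mul_eq hx hy fun l => ?_) i
  have h : ∑ j, y j * ((∑ i, dY j (fun x y => metric L x y i l) x y * spray L i x y)
      + 2 * ∑ i, metric L x y i l * nonlin L i j x y) = ∑ j, y j *
      ((1 / 2 : ℝ) * (dX j (dY l (sq L)) x y + (∑ k, y k * dX k (dY j (dY l (sq L))) x y)
        - dX l (dY j (sq L)) x y)) :=
    Finset.sum_congr rfl fun j _ => by rw [H.sum_metric_mul_nonlin hx hy]
  -- The derivative of the metric drops out because `y` annihilates it.
  have e1 : ∑ j, y j * ∑ i, dY j (fun x y => metric L x y i l) x y * spray L i x y = 0 := by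
    simp only [Finset.mul_sum]
    rw [Finset.sum_comm]
    refine Finset.sum_eq_zero fun i _ => ?_
    rw [← zero_mul (spray L i x y), ← H.sum_dY_metric_mul hx hy i l, Finset.sum_mul]
    exact Finset.sum_congr rfl fun j _ => by ring
  have e2 : ∑ j, y j * ∑ i, metric L x y i l * nonlin L i j x y =
      ∑ i, metric L x y i l * ∑ j, y j * nonlin L i j x y := by
    simp only [Finset.mul_sum]
    rw [Finset.sum_comm]
    exact Finset.sum_congr rfl fun i _ => Finset.sum_congr rfl fun j _ => by ring
  have e3 : ∑ j, y j * ∑ k, y k * dX k (dY j (dY l (sq L))) x y =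
      ∑ k, y k * dX k (dY l (sq L)) x y := by
    simp only [Finset.mul_sum]
    rw [Finset.sum_comm]
    refine Finset.sum_congr rfl fun k _ => ?_
    rw [← H.euler_dX_dY_sq hx hy k l, Finset.mul_sum]
    exact Finset.sum_congr rfl fun j _ => by ring
  have e4 := H.euler_dX_sq hx hy l
  have l1 : ∑ j, y j * ((∑ i, dY j (fun x y => metric L x y i l) x y * spray L i x y)
      + 2 * ∑ i, metric L x y i l * nonlin L i j x y) =
      2 * ∑ i, metric L x y i l * ∑ j, y j * nonlin L i j x y := by
    rw [← e2, ← zero_add (2 * _), ← e1, Finset.mul_sum, ← Finset.sum_add_distrib]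
    exact Finset.sum_congr rfl fun j _ => by ring
  have l2 : ∑ j, y j *
      ((1 / 2 : ℝ) * (dX j (dY l (sq L)) x y + (∑ k, y k * dX k (dY j (dY l (sq L))) x y)
        - dX l (dY j (sq L)) x y)) = (∑ k, y k * dX k (dY l (sq L)) x y) - dX l (sq L) x y := by
    calc _ = (1 / 2 : ℝ) * ((∑ j, y j * dX j (dY l (sq L)) x y)
          + (∑ j, y j * ∑ k, y k * dX k (dY j (dY l (sq L))) x y)
          - ∑ j, y j * dX l (dY j (sq L)) x y) := by
          rw [← Finset.sum_add_distrib, ← Finset.sum_sub_distrib, Finset.mul_sum]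
          exact Finset.sum_congr rfl fun j _ => by ring
      _ = _ := by rw [e3, e4]; ring
  rw [l1, l2] at h
  rw [H.sum_metric_mul_spray hx hy]
  linarith

/-- `L²` is horizontally constant: `δ_j L² = 0`. -/
lemma dX_sq_eq (H : IsLocalFinsler U L) (hx : x ∈ U) (hy : y ≠ 0) (j : Fin n) :
    dX j (sq L) x y = ∑ i, nonlin L i j x y * dY i (sq L) x y := by
  -- Here the contraction is over the lowered index `l`, since `y^l g_{il} = ½ ∂̇_i L²`.
  have h : ∑ l, y l * ((∑ i, dY j (fun x y => metric L x y i l) x y * spray L i x y)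
      + 2 * ∑ i, metric L x y i l * nonlin L i j x y) = ∑ l, y l *
      ((1 / 2 : ℝ) * (dX j (dY l (sq L)) x y + (∑ k, y k * dX k (dY j (dY l (sq L))) x y)
        - dX l (dY j (sq L)) x y)) :=
    Finset.sum_congr rfl fun l _ => by rw [H.sum_metric_mul_nonlin hx hy]
  have e1 : ∑ l, y l * ∑ i, dY j (fun x y => metric L x y i l) x y * spray L i x y = 0 := by
    simp only [Finset.mul_sum]
    rw [Finset.sum_comm]
    refine Finset.sum_eq_zero fun i _ => ?_
    rw [← zero_mul (spray L i x y), ← H.sum_dY_metric_mul_left hx hy j i, Finset.sum_mul]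
    exact Finset.sum_congr rfl fun j _ => by ring
  have e2 : ∑ l, y l * ∑ i, metric L x y i l * nonlin L i j x y =
      (1 / 2 : ℝ) * ∑ i, nonlin L i j x y * dY i (sq L) x y := by
    simp only [Finset.mul_sum]
    rw [Finset.sum_comm]
    refine Finset.sum_congr rfl fun i _ => ?_
    rw [mul_left_comm, ← H.sum_mul_metric hx hy, Finset.mul_sum]
    exact Finset.sum_congr rfl fun j _ => by ring
  have e3 : ∑ l, y l * ∑ k, y k * dX k (dY j (dY l (sq L))) x y =
      ∑ k, y k * dX k (dY j (sq L)) x y := by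
    simp only [Finset.mul_sum]
    rw [Finset.sum_comm]
    refine Finset.sum_congr rfl fun k _ => ?_
    rw [← H.euler_dX_dY_sq hx hy k j, Finset.mul_sum]
    exact Finset.sum_congr rfl fun l _ => by rw [H.dX_dY_dY_sq_comm hx hy k j l]; ring
  have e4 := H.euler_dX_sq hx hy j
  have l1 : ∑ l, y l * ((∑ i, dY j (fun x y => metric L x y i l) x y * spray L i x y)
      + 2 * ∑ i, metric L x y i l * nonlin L i j x y) =
      2 * ∑ l, y l * ∑ i, metric L x y i l * nonlin L i j x y := by
    rw [← zero_add (2 * _), ← e1, Finset.mul_sum, ← Finset.sum_add_distrib]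
    exact Finset.sum_congr rfl fun j _ => by ring
  have l2 : ∑ l, y l *
      ((1 / 2 : ℝ) * (dX j (dY l (sq L)) x y + (∑ k, y k * dX k (dY j (dY l (sq L))) x y)
        - dX l (dY j (sq L)) x y)) = dX j (sq L) x y := by
    calc _ = (1 / 2 : ℝ) * ((∑ l, y l * dX j (dY l (sq L)) x y)
          + (∑ l, y l * ∑ k, y k * dX k (dY j (dY l (sq L))) x y)
          - ∑ l, y l * dX l (dY j (sq L)) x y) := by
          rw [← Finset.sum_add_distrib, ← Finset.sum_sub_distrib, Finset.mul_sum]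
          exact Finset.sum_congr rfl fun j _ => by ring
      _ = _ := by rw [e3, e4]; ring
  rw [l1, l2, e2] at h
  linarith

/-- `L` is horizontally constant: `δ_j L = 0`. -/
lemma dX_eq (H : IsLocalFinsler U L) (hx : x ∈ U) (hy : y ≠ 0) (j : Fin n) :
    dX j L x y = ∑ i, nonlin L i j x y * dY i L x y := by
  have h := H.dX_sq_eq hx hy j
  have h0 : (2 * L x y) ≠ 0 := by have := H.pos x hx y hy; positivity
  simp only [H.dX_sq hx hy, H.dY_sq hx hy] at h
  apply mul_left_cancel₀ h0
  rw [h, Finset.mul_sum]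
  exact Finset.sum_congr rfl fun i _ => by ring

lemma dY_nonlin_comm (H : IsLocalFinsler U L) (hx : x ∈ U) (hy : y ≠ 0) (i j k : Fin n) :
    dY k (nonlin L i j) x y = dY j (nonlin L i k) x y := by
  have e : ∀ j k, dY k (nonlin L i j) x y = (1 / 2 : ℝ) * dY k (dY j (spray L i)) x y :=
    fun j k => dY_const_mul H.isOpen ((H.smooth_spray i).dY H.isOpen j) hx hy _ _
  rw [e, e, (H.smooth_spray i).dY_dY_comm H.isOpen hx hy]

/-- Obtained by differentiating `N^i_j y^j = S^i`, with no separate proof that the spray is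
homogeneous. The next two lemmas differentiate once more each. -/
lemma sum_dY_nonlin_mul (H : IsLocalFinsler U L) (hx : x ∈ U) (hy : y ≠ 0) (i k : Fin n) :
    ∑ j, y j * dY k (nonlin L i j) x y = nonlin L i k x y := by
  have h := dY_sum_coord_mul H.isOpen (fun j => H.smooth_nonlin i j) hx hy k
  rw [dY_congr (fun x hx y hy => H.sum_nonlin_mul hx hy i) hx hy] at h
  have e : dY k (spray L i) x y = 2 * nonlin L i k x y := by rw [nonlin]; ring
  linarith

lemma sum_dY_dY_nonlin_mul (H : IsLocalFinsler U L) (hx : x ∈ U) (hy : y ≠ 0)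
    (i h k : Fin n) : ∑ j, y j * dY h (dY k (nonlin L i j)) x y = 0 := by
  have h1 := dY_sum_coord_mul H.isOpen (fun j => (H.smooth_nonlin i j).dY H.isOpen k) hx hy h
  rw [dY_congr (fun x hx y hy => H.sum_dY_nonlin_mul hx hy i k) hx hy,
    H.dY_nonlin_comm hx hy] at h1
  linarith

lemma sum_dY_dY_dY_nonlin_mul (H : IsLocalFinsler U L) (hx : x ∈ U) (hy : y ≠ 0)
    (i l h k : Fin n) : ∑ j, y j * dY l (dY h (dY k (nonlin L i j))) x y =
      -dY h (dY k (nonlin L i l)) x y := by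
  have h1 := dY_sum_coord_mul H.isOpen
    (fun j => ((H.smooth_nonlin i j).dY H.isOpen k).dY H.isOpen h) hx hy l
  have h0 : dY l (fun _ _ => (0 : ℝ)) x y = 0 := by simp [dY]
  rw [dY_congr (fun x hx y hy => H.sum_dY_dY_nonlin_mul hx hy i h k) hx hy, h0] at h1
  linarith

/-! ### The Cartan coefficients and the torsion. -/

/-- The horizontal derivative of the fundamental tensor through the Berwald connection. -/
lemma dH_metric (H : IsLocalFinsler U L) (hx : x ∈ U) (hy : y ≠ 0) (j h k : Fin n) :
    dH L j (fun x y => metric L x y h k) x y =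
      (1 / 2 : ℝ) * (∑ i, dY h (dY k (nonlin L i j)) x y * dY i (sq L) x y)
        + (∑ i, dY k (nonlin L i j) x y * metric L x y i h)
        + ∑ i, dY h (nonlin L i j) x y * metric L x y i k := by
  have hQ := H.smooth_sq
  have hU := H.isOpen
  have hs := fun a b => (hQ.dY hU b).dY hU a
  have e1 : dX j (fun x y => metric L x y h k) x y =
      (1 / 2 : ℝ) * dY h (dY k (dX j (sq L))) x y := by
    rw [← dY_congr (fun x hx y hy => hQ.dX_dY_comm hU hx hy j k) hx hy h,
      ← (hQ.dY hU k).dX_dY_comm hU hx hy]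
    exact dX_const_mul hU (hs h k) hx hy _ _
  have e2 : ∀ r, dY r (fun x y => metric L x y h k) x y =
      (1 / 2 : ℝ) * dY h (dY k (dY r (sq L))) x y := fun r => by
    rw [dY_dY_dY_comm_left hU hQ hx hy, ← (hQ.dY hU k).dY_dY_comm hU hx hy]
    exact dY_const_mul hU (hs h k) hx hy _ _
  have e3 : dY h (dY k (dX j (sq L))) x y =
      dY h (dY k fun x y => ∑ i, nonlin L i j x y * dY i (sq L) x y) x y :=
    dY_congr (fun x hx y hy => dY_congr (fun x hx y hy => H.dX_sq_eq hx hy j) hx hy k) hx hy h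
  -- The terms `N^i_j ∂̇_h ∂̇_k ∂̇_i L²` from the product rule cancel the vertical part of `δ_j`.
  rw [dH, e1, e3, dY_dY_sum_mul hU (fun i => H.smooth_nonlin i j) (fun i => hQ.dY hU i) hx hy]
  simp only [e2, Finset.mul_sum]
  rw [← Finset.sum_sub_distrib, ← Finset.sum_add_distrib, ← Finset.sum_add_distrib]
  refine Finset.sum_congr rfl fun i _ => ?_
  rw [H.metric_comm hx hy i h, H.metric_comm hx hy i k, metric_apply, metric_apply]
  ring

/-- The Cartan horizontal coefficients through the Berwald ones. -/
lemma sum_metric_mul_cartan (H : IsLocalFinsler U L) (hx : x ∈ U) (hy : y ≠ 0)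
    (h j k : Fin n) :
    ∑ i, metric L x y i h * cartan L i j k x y =
      (1 / 4 : ℝ) * (∑ i, dY h (dY k (nonlin L i j)) x y * dY i (sq L) x y)
        + ∑ i, metric L x y i h * dY k (nonlin L i j) x y := by
  have e0 : ∑ i, metric L x y i h * cartan L i j k x y =
      (1 / 2 : ℝ) * (dH L j (fun x' y' => metric L x' y' h k) x y
      + dH L k (fun x' y' => metric L x' y' j h) x y
      - dH L h (fun x' y' => metric L x' y' j k) x y) := by
    rw [← H.sum_metric_mul_inv hx hy (fun l => dH L j (fun x' y' => metric L x' y' l k) x y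
      + dH L k (fun x' y' => metric L x' y' j l) x y
      - dH L l (fun x' y' => metric L x' y' j k) x y) h, Finset.mul_sum]
    exact Finset.sum_congr rfl fun i _ => by rw [cartan]; ring
  -- `∂̇_h ∂̇_k N^i_j` is symmetric in `h, k, j`, so of its three copies in the Christoffel
  -- combination one survives, and the factors `½ · ½` leave `1/4`.
  have c1 : ∀ i, dY j (dY h (nonlin L i k)) x y = dY h (dY k (nonlin L i j)) x y := fun i => by
    rw [(H.smooth_nonlin i k).dY_dY_comm H.isOpen hx hy,
      dY_congr (fun x hx y hy => H.dY_nonlin_comm hx hy i k j) hx hy]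
  have c2 : ∀ i, dY j (dY k (nonlin L i h)) x y = dY h (dY k (nonlin L i j)) x y := fun i => by
    rw [(H.smooth_nonlin i h).dY_dY_comm H.isOpen hx hy,
      dY_congr (fun x hx y hy => H.dY_nonlin_comm hx hy i h j) hx hy,
      (H.smooth_nonlin i j).dY_dY_comm H.isOpen hx hy]
  rw [e0, H.dH_metric hx hy, H.dH_metric hx hy, H.dH_metric hx hy]
  simp only [c1, c2, H.dY_nonlin_comm hx hy _ k h, H.dY_nonlin_comm hx hy _ j h,
    H.dY_nonlin_comm hx hy _ k j, mul_comm (metric L x y _ h)]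
  ring

/-- `Γ^i_{jk} y^j = N^i_k`. -/
lemma sum_cartan_mul (H : IsLocalFinsler U L) (hx : x ∈ U) (hy : y ≠ 0) (i k : Fin n) :
    ∑ j, cartan L i j k x y * y j = nonlin L i k x y := by
  refine congrFun (f := fun i => ∑ j, cartan L i j k x y * y j)
    (g := fun i => nonlin L i k x y) (H.eq_of_sum_metric_mul_eq hx hy fun h => ?_) i
  calc ∑ i, metric L x y i h * ∑ j, cartan L i j k x y * y j
      = ∑ j, y j * ∑ i, metric L x y i h * cartan L i j k x y := by
        simp only [Finset.mul_sum]
        rw [Finset.sum_comm]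
        exact Finset.sum_congr rfl fun i _ => Finset.sum_congr rfl fun j _ => by ring
    _ = (∑ i, (1 / 4 : ℝ) * dY i (sq L) x y * ∑ j, y j * dY h (dY k (nonlin L i j)) x y)
        + ∑ i, metric L x y i h * ∑ j, y j * dY k (nonlin L i j) x y := by
        simp only [H.sum_metric_mul_cartan hx hy, mul_add, Finset.sum_add_distrib,
          Finset.mul_sum]
        congr 1
        · rw [Finset.sum_comm]
          exact Finset.sum_congr rfl fun i _ => Finset.sum_congr rfl fun j _ => by ring
        · rw [Finset.sum_comm]
          exact Finset.sum_congr rfl fun i _ => Finset.sum_congr rfl fun j _ => by ring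
    _ = _ := by simp [H.sum_dY_dY_nonlin_mul hx hy, H.sum_dY_nonlin_mul hx hy]

/-- The `(v)hv`-torsion is the Landsberg tensor. -/
lemma torsionPLow_eq_landsberg (H : IsLocalFinsler U L) (hx : x ∈ U) (hy : y ≠ 0)
    (h j k : Fin n) :
    torsionPLow L h j k x y =
      -(1 / 2 : ℝ) * L x y * ∑ i, dY h (dY j (nonlin L i k)) x y * dY i L x y := by
  -- The indices are swapped because the torsion uses `Γ^i_{kj}`; the Berwald part then cancels by
  -- symmetry of `∂̇_k N^i_j`.
  have h1 := H.sum_metric_mul_cartan hx hy h k j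
  simp only [torsionPLow, torsionP, mul_sub, Finset.sum_sub_distrib,
    H.dY_nonlin_comm hx hy _ j k, h1, H.dY_sq hx hy]
  have : ∑ i, dY h (dY j (nonlin L i k)) x y * (2 * L x y * dY i L x y) =
      2 * L x y * ∑ i, dY h (dY j (nonlin L i k)) x y * dY i L x y := by
    rw [Finset.mul_sum]; exact Finset.sum_congr rfl fun i _ => by ring
  rw [this]
  ring

/-- Reversing the order of differentiation matches the product-rule output, where `∂̇_r L` is
innermost. -/
lemma L3_eq (H : IsLocalFinsler U L) (hx : x ∈ U) (hy : y ≠ 0) (h j r : Fin n) :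
    L3 L h j r x y = dY h (dY j (dY r L)) x y := by
  rw [L3, (H.smooth.dY H.isOpen h).dY_dY_comm H.isOpen hx hy,
    dY_dY_dY_comm_left H.isOpen H.smooth hx hy,
    (H.smooth.dY H.isOpen r).dY_dY_comm H.isOpen hx hy]

lemma L4_eq (H : IsLocalFinsler U L) (hx : x ∈ U) (hy : y ≠ 0) (h j k r : Fin n) :
    L4 L h j k r x y = dY h (dY j (dY k (dY r L))) x y := by
  have hs := H.smooth
  have hU := H.isOpen
  rw [L4, dY_congr (fun x hx y hy => H.L3_eq hx hy h j k) hx hy,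
    ((hs.dY hU k).dY hU j).dY_dY_comm hU hx hy]
  refine dY_congr (fun x hx y hy => ?_) hx hy h
  rw [(hs.dY hU k).dY_dY_comm hU hx hy, dY_dY_dY_comm_left hU hs hx hy]

lemma dX_L3 (H : IsLocalFinsler U L) (hx : x ∈ U) (hy : y ≠ 0) (m h j k : Fin n) :
    dX m (L3 L h j k) x y = dY h (dY j (dY k (dX m L))) x y := by
  have hs := H.smooth
  have hU := H.isOpen
  rw [dX_congr hU (fun x hx y hy => H.L3_eq hx hy h j k) hx hy,
    ((hs.dY hU k).dY hU j).dX_dY_comm hU hx hy]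
  refine dY_congr (fun x hx y hy => ?_) hx hy h
  rw [(hs.dY hU k).dX_dY_comm hU hx hy]
  exact dY_congr (fun x hx y hy => hs.dX_dY_comm hU hx hy m k) hx hy j

/-- The Landsberg tensor as the horizontal derivative of `L_{hjk}` along `y`. -/
lemma torsionPLow_eq (H : IsLocalFinsler U L) (hx : x ∈ U) (hy : y ≠ 0) (h j k : Fin n) :
    torsionPLow L h j k x y = L x y / 2 * ((∑ m, y m * dX m (L3 L h j k) x y)
      - (∑ r, L4 L h j k r x y * spray L r x y)
      - (∑ r, L3 L h j r x y * nonlin L r k x y)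
      - (∑ r, L3 L h k r x y * nonlin L r j x y)
      - ∑ r, L3 L j k r x y * nonlin L r h x y) := by
  have hs := H.smooth
  have hU := H.isOpen
  have e : ∀ m, dX m (L3 L h j k) x y =
      dY h (dY j (dY k fun x y => ∑ i, nonlin L i m x y * dY i L x y)) x y := fun m => by
    rw [H.dX_L3 hx hy]
    exact dY_congr (fun x hx y hy => dY_congr (fun x hx y hy =>
      dY_congr (fun x hx y hy => H.dX_eq hx hy m) hx hy k) hx hy j) hx hy h
  -- The Leibniz expansion is regrouped so that every derivative of `N^i_m` is contracted with `y^m`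
  -- and an Euler identity applies to each bracket.
  have e1 : ∑ m, y m * dX m (L3 L h j k) x y =
      ∑ i, ((∑ m, y m * dY h (dY j (dY k (nonlin L i m))) x y) * dY i L x y
        + (∑ m, y m * dY j (dY k (nonlin L i m)) x y) * dY h (dY i L) x y
        + (∑ m, y m * dY h (dY k (nonlin L i m)) x y) * dY j (dY i L) x y
        + (∑ m, y m * dY h (dY j (nonlin L i m)) x y) * dY k (dY i L) x y
        + (∑ m, y m * dY k (nonlin L i m) x y) * dY h (dY j (dY i L)) x y
        + (∑ m, y m * dY j (nonlin L i m) x y) * dY h (dY k (dY i L)) x y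
        + (∑ m, y m * dY h (nonlin L i m) x y) * dY j (dY k (dY i L)) x y
        + (∑ m, y m * nonlin L i m x y) * dY h (dY j (dY k (dY i L))) x y) := by
    simp only [e, dY_dY_dY_sum_mul hU (fun i => H.smooth_nonlin i _) (fun i => hs.dY hU i) hx hy,
      Finset.mul_sum, Finset.sum_mul, ← Finset.sum_add_distrib]
    rw [Finset.sum_comm]
    exact Finset.sum_congr rfl fun i _ => Finset.sum_congr rfl fun j _ => by ring
  have c : ∀ i, dY j (dY k (nonlin L i h)) x y = dY h (dY j (nonlin L i k)) x y := fun i => by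
    rw [dY_congr (fun x hx y hy => H.dY_nonlin_comm hx hy i h k) hx hy,
      (H.smooth_nonlin i k).dY_dY_comm H.isOpen hx hy]
  rw [H.torsionPLow_eq_landsberg hx hy, e1]
  simp only [H.sum_dY_dY_dY_nonlin_mul hx hy, H.sum_dY_dY_nonlin_mul hx hy,
    H.sum_dY_nonlin_mul hx hy, H.sum_nonlin_mul hx hy, H.L3_eq hx hy, H.L4_eq hx hy, c,
    ← Finset.sum_sub_distrib, Finset.mul_sum]
  exact Finset.sum_congr rfl fun i _ => by ring

/-! ### Comparison of two Finsler metrics. -/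

variable {L' : EuclideanSpace ℝ (Fin n) → EuclideanSpace ℝ (Fin n) → ℝ}

lemma diffTensor0_eq (H : IsLocalFinsler U L) (H' : IsLocalFinsler U L') (hx : x ∈ U)
    (hy : y ≠ 0) (i k : Fin n) :
    diffTensor0 L L' i k x y = nonlin L' i k x y - nonlin L i k x y := by
  simp only [diffTensor0, diffTensor, sub_mul, Finset.sum_sub_distrib,
    H.sum_cartan_mul hx hy, H'.sum_cartan_mul hx hy]

lemma diffTensor00_eq (H : IsLocalFinsler U L) (H' : IsLocalFinsler U L') (hx : x ∈ U)
    (hy : y ≠ 0) (i : Fin n) :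
    diffTensor00 L L' i x y = spray L' i x y - spray L i x y := by
  have e : diffTensor00 L L' i x y = ∑ k, y k * diffTensor0 L L' i k x y := by
    simp only [diffTensor00, diffTensor0, Finset.mul_sum]
    rw [Finset.sum_comm]
    exact Finset.sum_congr rfl fun i _ => Finset.sum_congr rfl fun j _ => by ring
  simp only [e, H.diffTensor0_eq H' hx hy, mul_sub, Finset.sum_sub_distrib,
    H.sum_nonlin_mul hx hy, H'.sum_nonlin_mul hx hy]

/-- The change of the lowered `(v)hv`-torsion when the third vertical derivatives of the
metric function are rescaled by a function `ρ` of the position. -/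
lemma torsionPLow_of_L3_eq (H : IsLocalFinsler U L) (H' : IsLocalFinsler U L')
    {ρ : EuclideanSpace ℝ (Fin n) → ℝ} (hρ : SmoothOn U (fun x _ => ρ x))
    (hL3 : ∀ h j k, ∀ x ∈ U, ∀ y, y ≠ 0 → L3 L' h j k x y = ρ x * L3 L h j k x y)
    (hx : x ∈ U) (hy : y ≠ 0) (h j k : Fin n) :
    torsionPLow L' h j k x y = ρ x * L' x y / L x y * torsionPLow L h j k x y
      - L' x y / 2 * (ρ x * ((∑ r, L4 L h j k r x y * diffTensor00 L L' r x y)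
          + (∑ r, L3 L h j r x y * diffTensor0 L L' r k x y)
          + (∑ r, L3 L h k r x y * diffTensor0 L L' r j x y)
          + (∑ r, L3 L j k r x y * diffTensor0 L L' r h x y))
        - (∑ m, y m * dX m (fun x _ => ρ x) x y) * L3 L h j k x y) := by
  have hU := H.isOpen
  have s3 : SmoothOn U (L3 L h j k) := ((H.smooth.dY hU h).dY hU j).dY hU k
  -- The factor `ρ` depends on position only, so it passes through `∂̇_r`; under `∂_m` in `hd` it
  -- contributes the additional term.
  have h4 : ∀ r, L4 L' h j k r x y = ρ x * L4 L h j k r x y := fun r => by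
    rw [L4, dY_congr (hL3 h j k) hx hy, dY_mul hU hρ s3 hx hy]
    simp [dY, L4]
  have hd : ∀ m, dX m (L3 L' h j k) x y =
      dX m (fun x _ => ρ x) x y * L3 L h j k x y + ρ x * dX m (L3 L h j k) x y := fun m => by
    rw [dX_congr hU (hL3 h j k) hx hy, dX_mul hU hρ s3 hx hy]
  have hp := (H.pos x hx y hy).ne'
  rw [H'.torsionPLow_eq hx hy, H.torsionPLow_eq hx hy]
  simp only [h4, hd, hL3 _ _ _ x hx y hy, H.diffTensor0_eq H' hx hy, H.diffTensor00_eq H' hx hy,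
    mul_sub, mul_add, Finset.sum_sub_distrib, Finset.sum_add_distrib, ← mul_assoc,
    mul_comm (_ : ℝ) (ρ x)]
  simp only [mul_assoc, ← Finset.mul_sum]
  simp only [← mul_assoc, ← Finset.sum_mul]
  field_simp
  ring

end IsLocalFinsler

end LocalFinsler

end Finsler

end

noncomputable section

namespace Finsler

/-! ### From the manifold to natural coordinates. -/

section Charts

variable {n : ℕ} {M : Type*} [TopologicalSpace M] [ChartedSpace (EuclideanSpace ℝ (Fin n)) M]
  {e : OpenPartialHomeomorph M (EuclideanSpace ℝ (Fin n))}

lemma mdifferentiable_of_mem_maximalAtlas (he : e ∈ IsManifold.maximalAtlas (𝓡 n) ∞ M) :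
    e.MDifferentiable (𝓡 n) (𝓡 n) :=
  ⟨(contMDiffOn_of_mem_maximalAtlas he).mdifferentiableOn (by simp),
    (contMDiffOn_symm_of_mem_maximalAtlas he).mdifferentiableOn (by simp)⟩

/-- The differential of a chart inverse is injective, so the slit bundle of the chart domain maps
into the slit bundle of `M`. -/
lemma mfderiv_symm_ne_zero (he : e ∈ IsManifold.maximalAtlas (𝓡 n) ∞ M)
    {x y : EuclideanSpace ℝ (Fin n)} (hx : x ∈ e.target) (hy : y ≠ 0) :
    mfderiv (𝓡 n) (𝓡 n) e.symm x y ≠ 0 := fun h =>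
  hy ((mdifferentiable_of_mem_maximalAtlas he).symm.mfderiv_injective hx
    (h.trans (map_zero _).symm))

variable [IsManifold (𝓡 n) ∞ M]

/-- The natural parametrization of the tangent bundle is smooth. -/
lemma contMDiffOn_natural_coordinates (he : e ∈ IsManifold.maximalAtlas (𝓡 n) ∞ M) :
    ContMDiffOn 𝓘(ℝ, EuclideanSpace ℝ (Fin n) × EuclideanSpace ℝ (Fin n)) (𝓡 n).tangent ∞
      (fun p : EuclideanSpace ℝ (Fin n) × EuclideanSpace ℝ (Fin n) =>
        (⟨e.symm p.1, mfderiv (𝓡 n) (𝓡 n) e.symm p.1 p.2⟩ : TangentBundle (𝓡 n) M))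
      (e.target ×ˢ Set.univ) := by
  have h1 := (contMDiffOn_symm_of_mem_maximalAtlas he).contMDiffOn_tangentMapWithin
    (m := ∞) (by simp) e.open_target.uniqueMDiffOn
  have h2 : ContMDiff 𝓘(ℝ, EuclideanSpace ℝ (Fin n) × EuclideanSpace ℝ (Fin n))
      (𝓡 n).tangent ∞
      (fun p : EuclideanSpace ℝ (Fin n) × EuclideanSpace ℝ (Fin n) =>
        (⟨p.1, p.2⟩ : TangentBundle (𝓡 n) (EuclideanSpace ℝ (Fin n)))) := by
    intro p
    rw [Bundle.contMDiffAt_totalSpace]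
    refine ⟨contDiff_fst.contMDiff.contMDiffAt, ?_⟩
    refine (contDiff_snd.contMDiff (n := ∞)).contMDiffAt.congr_of_eventuallyEq ?_
    exact Filter.Eventually.of_forall fun q => by simp
  refine (h1.comp h2.contMDiffOn (s := e.target ×ˢ Set.univ) fun p hp => hp.1).congr
    fun p hp => ?_
  have := tangentMapWithin_eq_tangentMap (I := 𝓡 n) (I' := 𝓡 n)
    (p := (⟨p.1, p.2⟩ : TangentBundle (𝓡 n) (EuclideanSpace ℝ (Fin n))))
    (e.open_target.uniqueMDiffOn p.1 hp.1)
    ((mdifferentiable_of_mem_maximalAtlas he).mdifferentiableAt_symm hp.1)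
  exact this.symm

lemma smoothOn_inChart (he : e ∈ IsManifold.maximalAtlas (𝓡 n) ∞ M)
    {F : TangentBundle (𝓡 n) M → ℝ}
    (hF : ContMDiffOn (𝓡 n).tangent 𝓘(ℝ, ℝ) ∞ F {v | v.2 ≠ 0}) :
    SmoothOn e.target (inChart e F) := by
  rw [SmoothOn, ← contMDiffOn_iff_contDiffOn]
  exact hF.comp ((contMDiffOn_natural_coordinates he).mono
    (Set.prod_mono_right (Set.subset_univ _))) fun p hp => mfderiv_symm_ne_zero he hp.1 hp.2

lemma IsFinslerMetric.isLocalFinsler {L : TangentBundle (𝓡 n) M → ℝ} (hL : IsFinslerMetric L)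
    (he : e ∈ IsManifold.maximalAtlas (𝓡 n) ∞ M) : IsLocalFinsler e.target (inChart e L) where
  isOpen := e.open_target
  smooth := smoothOn_inChart he hL.smooth
  pos x hx y hy := hL.pos _ (mfderiv_symm_ne_zero he hx hy)
  homogeneous x _ y _ c hc := by
    have h := (mfderiv (𝓡 n) (𝓡 n) e.symm x).map_smul c y
    exact (congrArg (fun v => L ⟨e.symm x, v⟩) h).trans (hL.homogeneous _ _ c hc)
  posDef := hL.posDef e he

/-- The terms of the `β`-conformal change linear in `y` do not contribute to `L_{hjk}`. -/
lemma L3_betaConformal {L : TangentBundle (𝓡 n) M → ℝ} (hL : IsFinslerMetric L) (σ : M → ℝ)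
    (b : ∀ p : M, TangentSpace (𝓡 n) p →L[ℝ] ℝ)
    (he : e ∈ IsManifold.maximalAtlas (𝓡 n) ∞ M) (h j k : Fin n)
    (x : EuclideanSpace ℝ (Fin n)) (hx : x ∈ e.target) (y : EuclideanSpace ℝ (Fin n))
    (hy : y ≠ 0) :
    L3 (inChart e (betaConformal L σ b)) h j k x y =
      Real.exp (σ (e.symm x)) * L3 (inChart e L) h j k x y := by
  have H := hL.isLocalFinsler he
  have hU := H.isOpen
  let ℓ : EuclideanSpace ℝ (Fin n) →L[ℝ] ℝ :=
    (b (e.symm x)).comp (mfderiv (𝓡 n) (𝓡 n) e.symm x)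
  let c := Real.exp (σ (e.symm x))
  -- After one vertical derivative the linear form `ℓ` is a constant, absorbed in `a`. The trailing
  -- `+ 0` puts the conclusion in the form of the hypothesis, so the step can be repeated with `a =
  -- 0`.
  have key : ∀ i, ∀ {f : EuclideanSpace ℝ (Fin n) → EuclideanSpace ℝ (Fin n) → ℝ},
      SmoothOn e.target f → ∀ a : ℝ,
      ∀ {g : EuclideanSpace ℝ (Fin n) → EuclideanSpace ℝ (Fin n) → ℝ},
      (∀ y, y ≠ 0 → g x y = c * f x y + a) → ∀ y, y ≠ 0 → dY i g x y = c * dY i f x y + 0 := by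
    intro i f hf a g hg y hy
    have hev : (fun y' => g x y') =ᶠ[nhds y] fun y' => c * f x y' + a :=
      Filter.eventuallyEq_of_mem (isOpen_compl_singleton.mem_nhds hy) hg
    have hd := hf.differentiableAt_right hU hx hy
    simp only [dY, hev.fderiv_eq]
    rw [fderiv_add_const, fderiv_const_mul hd]
    simp
  have h1 : ∀ y, y ≠ 0 → dY h (inChart e (betaConformal L σ b)) x y =
      c * dY h (inChart e L) x y + ℓ (EuclideanSpace.single h 1) := by
    intro y hy
    have hd := H.smooth.differentiableAt_right hU hx hy
    have hℓ : (fun y' => inChart e (betaConformal L σ b) x y') =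
        fun y' => c * inChart e L x y' + ℓ y' := rfl
    simp only [dY, hℓ]
    rw [fderiv_fun_add (hd.const_mul c) ℓ.differentiableAt, fderiv_const_mul hd, ℓ.fderiv]
    simp
  have h2 := key j (H.smooth.dY hU h) _ h1
  simpa [L3, c] using key k ((H.smooth.dY hU h).dY hU j) 0 h2 y hy

end Charts

end Finsler

end

namespace Finsler

lemma contDiffOn_comp_symm {n : ℕ} {M : Type*} [TopologicalSpace M]
    [ChartedSpace (EuclideanSpace ℝ (Fin n)) M]
    {e : OpenPartialHomeomorph M (EuclideanSpace ℝ (Fin n))}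
    (he : e ∈ IsManifold.maximalAtlas (𝓡 n) ∞ M) {σ : M → ℝ}
    (hσ : ContMDiff (𝓡 n) 𝓘(ℝ, ℝ) ∞ σ) :
    ContDiffOn ℝ ∞ (fun x => σ (e.symm x)) e.target := by
  rw [← contMDiffOn_iff_contDiffOn]
  exact hσ.comp_contMDiffOn (contMDiffOn_symm_of_mem_maximalAtlas he)

end Finsler

theorem proposition4p5 {n : ℕ} {M : Type*} [TopologicalSpace M]
    [ChartedSpace (EuclideanSpace ℝ (Fin n)) M] [IsManifold (𝓡 n) ∞ M]
    (L : TangentBundle (𝓡 n) M → ℝ) (hL : Finsler.IsFinslerMetric L)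
    (σ : M → ℝ) (hσ : ContMDiff (𝓡 n) 𝓘(ℝ, ℝ) ∞ σ)
    (b : ∀ p : M, TangentSpace (𝓡 n) p →L[ℝ] ℝ)
    (hb : ContMDiff (𝓡 n).tangent 𝓘(ℝ, ℝ) ∞
      (fun v : TangentBundle (𝓡 n) M => b v.proj v.2))
    (hL' : Finsler.IsFinslerMetric (Finsler.betaConformal L σ b))
    (e : OpenPartialHomeomorph M (EuclideanSpace ℝ (Fin n)))
    (he : e ∈ IsManifold.maximalAtlas (𝓡 n) ∞ M)
    (x : EuclideanSpace ℝ (Fin n)) (hx : x ∈ e.target)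
    (y : EuclideanSpace ℝ (Fin n)) (hy : y ≠ 0) (h j k : Fin n) :
    let Λ := Finsler.inChart e L
    let Λ' := Finsler.inChart e (Finsler.betaConformal L σ b)
    let τ : ℝ := Real.exp (σ (e.symm x)) * Λ' x y / Λ x y
    Finsler.torsionPLow Λ' h j k x y =
      τ * Finsler.torsionPLow Λ h j k x y
        - τ * Λ x y / 2 *
          ((∑ r, Finsler.L4 Λ h j k r x y * Finsler.diffTensor00 Λ Λ' r x y)
            + (∑ r, Finsler.L3 Λ h j r x y * Finsler.diffTensor0 Λ Λ' r k x y)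
            + (∑ r, Finsler.L3 Λ h k r x y * Finsler.diffTensor0 Λ Λ' r j x y)
            + (∑ r, Finsler.L3 Λ j k r x y * Finsler.diffTensor0 Λ Λ' r h x y)
            - Finsler.sigma0 e σ x y * Finsler.L3 Λ h j k x y) := by
  intro Λ Λ' τ
  have H := hL.isLocalFinsler he
  have H' := hL'.isLocalFinsler he
  have hs := Finsler.contDiffOn_comp_symm he hσ
  have hρ : Finsler.SmoothOn e.target fun x _ => Real.exp (σ (e.symm x)) :=
    Real.contDiff_exp.comp_contDiffOn
      (hs.comp contDiff_fst.contDiffOn fun p (hp : p ∈ Finsler.slit e.target) => hp.1)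
  rw [H.torsionPLow_of_L3_eq H' hρ (Finsler.L3_betaConformal hL σ b he) hx hy]
  -- The chain rule brings out `e^σ`, so the `σ_0` term shares the prefactor `τ Λ / 2 = e^σ Λ' / 2`
  -- with the others.
  have hd : ∑ m, y m * Finsler.dX m (fun x _ => Real.exp (σ (e.symm x))) x y =
      Real.exp (σ (e.symm x)) * Finsler.sigma0 e σ x y := by
    have hdiff : DifferentiableAt ℝ (fun x => σ (e.symm x)) x :=
      (hs.contDiffAt (e.open_target.mem_nhds hx)).differentiableAt (by simp)
    simp only [Finsler.dX, Finsler.sigma0, fderiv_exp hdiff, Finset.mul_sum]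
    exact Finset.sum_congr rfl fun m _ => by simp; ring
  have hp := (H.pos x hx y hy).ne'
  rw [hd]
  simp only [τ, Λ, Λ']
  field_simp
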